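/- Let $K$ be a field of characteristic zero, let $V$ be a $K$-vector space with basis $(e_1,e_2,e_3)$, and let $\mathfrak g=(V,[\,,])$ and $\mathfrak n=(V,\{\,,\})$ be two Lie algebras on $V$, where $\mathfrak g=\mathfrak n_3(K)$ is the Heisenberg Lie algebra with $[e_1,e_2]=e_3$, $[e_1,e_3]=[e_2,e_3]=0$, and $\mathfrak n\cong\mathfrak g$ as Lie algebras. A PA-structure on $(\mathfrak g,\mathfrak n)$ is a $K$-bilinear product $x\cdot y$ on $V$ such that for all $x,y,z\in V$ $$x\cdot y-y\cdot x=[x,y]-\{x,y\},\quad [x,y]\cdot z=x\cdot(y\cdot z)-y\cdot(x\cdot z),\quad x\cdot\{y,z\}=\{x\cdot y,z\}+\{y,x\cdot z\}.$$ Write $L(x)(y)=x\cdot y$, $\operatorname{Ad}(x)(y)=\{x,y\}$, and let $r=(r_1,\dots,r_9)\in K^9$ be the structure constants of $\mathfrak n$: $$\{e_1,e_2\}=r_1e_1+r_2e_2+r_3e_3,\quad \{e_1,e_3\}=r_4e_1+r_5e_2+r_6e_3,\quad \{e_2,e_3\}=r_7e_1+r_8e_2+r_9e_3.$$ Operators are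 identified with their matrices in the basis $(e_1,e_2,e_3)$, the $j$-th column being the coordinates of the image of $e_j$. **Proposition 5.2.** A $K$-bilinear product $x\cdot y$ on $V$ is a PA-structure on $(\mathfrak g,\mathfrak n)$ if and only if $L(e_3)=-\tfrac12\operatorname{Ad}(e_3)$ and $(r,L(e_1),L(e_2))$ is in one of the following six families, for some parameters in $K$. 1. (type $A$) $r=\left(r_1,r_2,r_3,-\frac{r_1r_2}{r_3},-\frac{r_2^2}{r_3},-r_2,\frac{r_1^2}{r_3},\frac{r_1r_2}{r_3},r_1\right)$ with $r_2,r_3\neq0$, and $$L(e_1)=\begin{pmatrix}\frac{r_1\alpha}{r_2}&-\frac{r_1(2r_1\alpha+r_2^2)}{2r_2^2}&\frac{r_1r_2}{2r_3}\\ \alpha&-\frac{2r_1\alpha+r_2^2}{2r_2}&\frac{r_2^2}{2r_3}\\ \beta&-\frac{2r_1\beta+r_2r_3}{2r_2}&\frac{r_2}{2}\end{pmatrix},\quad L(e_2)=\begin{pmatrix}\frac{r_1(r_2^2-2r_1\alpha)}{2r_2^2}&\frac{r_1^3\alpha}{r_2^3}&-\frac{r_1^2}{2r_3}\\ \frac{r_2^2-2r_1\alpha}{2r_2}&\frac{r_1^2\alpha}{r_2^2}&-\frac{r_1r_2}{2r_3}\\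 \frac{r_2(r_3-2)-2r_1\beta}{2r_2}&\frac{r_1(r_1\beta+r_2)}{r_2^2}&-\frac{r_1}{2}\end{pmatrix}.$$ 2. (type $A$) $r=\left(r_1,0,r_3,0,0,0,\frac{r_1^2}{r_3},0,r_1\right)$ with $r_3\neq0$, and $$L(e_1)=\begin{pmatrix}0&-\frac{r_1}{2}&0\\0&0&0\\0&\frac{2-r_3}{2}&0\end{pmatrix},\quad L(e_2)=\begin{pmatrix}\frac{r_1}{2}&\alpha&-\frac{r_1^2}{2r_3}\\0&0&0\\ \frac{r_3}{2}&\beta&-\frac{r_1}{2}\end{pmatrix}.$$ 3. (type $A$) $r=(0,0,r_3,0,0,0,0,0,0)$ with $r_3\neq0$, and $$L(e_1)=\begin{pmatrix}\alpha&-\frac{\alpha^2}{\beta}&0\\ \beta&-\alpha&0\\ \gamma&\delta&0\end{pmatrix},\quad L(e_2)=\begin{pmatrix}-\frac{\alpha^2}{\beta}&\frac{\alpha^3}{\beta^2}&0\\-\alpha&\frac{\alpha^2}{\beta}&0\\ r_3-1+\delta&\frac{\alpha(\beta(1-r_3)-\alpha\gamma-2\beta\delta)}{\beta^2}&0\end{pmatrix}$$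 with $\beta\neq0$. 4. (type $A$) $r=(0,0,r_3,0,0,0,0,0,0)$ with $r_3\neq0$, and $$L(e_1)=\begin{pmatrix}0&0&0\\0&0&0\\ \alpha&\beta&0\end{pmatrix},\quad L(e_2)=\begin{pmatrix}0&\gamma&0\\0&0&0\\ r_3-1+\beta&\delta&0\end{pmatrix}$$ with $\alpha\gamma=0$. 5. (type $B$) $r=\left(0,0,0,r_4,r_5,0,-\frac{r_4^2}{r_5},-r_4,0\right)$ with $r_5\neq0$, and $$L(e_1)=\begin{pmatrix}\frac{r_4\alpha}{r_5}&-\frac{r_4^2\alpha}{r_5^2}&-\frac{r_4}{2}\\ \alpha&-\frac{r_4\alpha}{r_5}&-\frac{r_5}{2}\\ \beta&-\frac{r_4\beta}{r_5}&0\end{pmatrix},\quad L(e_2)=\begin{pmatrix}-\frac{r_4^2\alpha}{r_5^2}&\frac{r_4^3\alpha}{r_5^3}&\frac{r_4^2}{2r_5}\\-\frac{r_4\alpha}{r_5}&\frac{r_4^2\alpha}{r_5^2}&\frac{r_4}{2}\\-\frac{r_4\beta+r_5}{r_5}&\frac{r_4(r_4\beta+r_5)}{r_5^2}&0\end{pmatrix}.$$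 6. (type $C$) $r=(0,0,0,0,0,0,r_7,0,0)$ with $r_7\neq0$, and $$L(e_1)=\begin{pmatrix}0&0&0\\0&0&0\\0&1&0\end{pmatrix},\quad L(e_2)=\begin{pmatrix}0&\alpha&-\frac{r_7}{2}\\0&0&0\\0&\beta&0\end{pmatrix}.$$ -/

import Mathlib

/-- A bilinear map `b` on `V` is a Lie bracket: it is alternating and satisfies the Jacobi
identity. -/
def IsLieBracket {K V : Type*} [Field K] [AddCommGroup V] [Module K V]
    (b : V →ₗ[K] V →ₗ[K] V) : Prop :=
  (∀ x : V, b x x = 0) ∧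
    ∀ x y z : V, b x (b y z) + b y (b z x) + b z (b x y) = 0

/-- The Lie algebras `(V, b)` and `(V, c)` are isomorphic. -/
def BracketsIsomorphic {K V : Type*} [Field K] [AddCommGroup V] [Module K V]
    (b c : V →ₗ[K] V →ₗ[K] V) : Prop :=
  ∃ φ : V ≃ₗ[K] V, ∀ x y : V, φ (b x y) = c (φ x) (φ y)

/-- `e = (e₁, e₂, e₃)` (indexed by `0, 1, 2`) is a basis in which the bracket `b` is the bracket of
the Heisenberg Lie algebra `𝔫₃(K)`: `[e₁, e₂] = e₃` and `e₃` is central. -/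
def IsHeisenbergBasis {K V : Type*} [Field K] [AddCommGroup V] [Module K V]
    (e : Module.Basis (Fin 3) K V) (b : V →ₗ[K] V →ₗ[K] V) : Prop :=
  b (e 0) (e 1) = e 2 ∧ b (e 0) (e 2) = 0 ∧ b (e 1) (e 2) = 0

/-- The bilinear product `dot` is a post-Lie algebra structure (PA-structure) on the pair
`(𝔤, 𝔫)` with `𝔤 = (V, g)` and `𝔫 = (V, n)`. -/
structure IsPAStructure {K V : Type*} [Field K] [AddCommGroup V] [Module K V]
    (g n dot : V →ₗ[K] V →ₗ[K] V) : Prop where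
  post1 : ∀ x y : V, dot x y - dot y x = g x y - n x y
  post2 : ∀ x y z : V, dot (g x y) z = dot x (dot y z) - dot y (dot x z)
  post3 : ∀ x y z : V, dot x (n y z) = n (dot x y) z + n y (dot x z)

/-- The structure constants of the bracket `n` in the basis `e` are `r = (r₁, …, r₉)`
(indexed by `0, …, 8`). -/
def HasStructureConstants {K V : Type*} [Field K] [AddCommGroup V] [Module K V]
    (e : Module.Basis (Fin 3) K V) (n : V →ₗ[K] V →ₗ[K] V) (r : Fin 9 → K) : Prop :=
  n (e 0) (e 1) = r 0 • e 0 + r 1 • e 1 + r 2 • e 2 ∧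
  n (e 0) (e 2) = r 3 • e 0 + r 4 • e 1 + r 5 • e 2 ∧
  n (e 1) (e 2) = r 6 • e 0 + r 7 • e 1 + r 8 • e 2

/-- Structure constants of type `A` (to be used with `r₃ ≠ 0`). -/
def typeA {K : Type*} [Field K] (r₁ r₂ r₃ : K) : Fin 9 → K :=
  ![r₁, r₂, r₃, -(r₁ * r₂ / r₃), -(r₂ ^ 2 / r₃), -r₂, r₁ ^ 2 / r₃, r₁ * r₂ / r₃, r₁]

/-- Structure constants of type `B` (to be used with `r₅ ≠ 0`). -/
def typeB {K : Type*} [Field K] (r₄ r₅ : K) : Fin 9 → K :=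
  ![0, 0, 0, r₄, r₅, 0, -(r₄ ^ 2 / r₅), -r₄, 0]

/-- Structure constants of type `C` (to be used with `r₇ ≠ 0`). -/
def typeC {K : Type*} [Field K] (r₇ : K) : Fin 9 → K :=
  ![0, 0, 0, 0, 0, 0, r₇, 0, 0]

/-- The first family: type `A` with `r₂ ≠ 0`. -/
def IsFamily1 {K : Type*} [Field K] (r : Fin 9 → K) (L₁ L₂ : Matrix (Fin 3) (Fin 3) K) : Prop :=
  ∃ r₁ r₂ r₃ α β : K, r₂ ≠ 0 ∧ r₃ ≠ 0 ∧ r = typeA r₁ r₂ r₃ ∧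
    L₁ = !![r₁ * α / r₂, -(r₁ * (2 * r₁ * α + r₂ ^ 2) / (2 * r₂ ^ 2)), r₁ * r₂ / (2 * r₃);
            α, -((2 * r₁ * α + r₂ ^ 2) / (2 * r₂)), r₂ ^ 2 / (2 * r₃);
            β, -((2 * r₁ * β + r₂ * r₃) / (2 * r₂)), r₂ / 2] ∧
    L₂ = !![r₁ * (r₂ ^ 2 - 2 * r₁ * α) / (2 * r₂ ^ 2), r₁ ^ 3 * α / r₂ ^ 3,
              -(r₁ ^ 2 / (2 * r₃));
            (r₂ ^ 2 - 2 * r₁ * α) / (2 * r₂), r₁ ^ 2 * α / r₂ ^ 2, -(r₁ * r₂ / (2 * r₃));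
            (r₂ * (r₃ - 2) - 2 * r₁ * β) / (2 * r₂), r₁ * (r₁ * β + r₂) / r₂ ^ 2, -(r₁ / 2)]

/-- The second family: type `A` with `r₂ = 0`. -/
def IsFamily2 {K : Type*} [Field K] (r : Fin 9 → K) (L₁ L₂ : Matrix (Fin 3) (Fin 3) K) : Prop :=
  ∃ r₁ r₃ α β : K, r₃ ≠ 0 ∧ r = ![r₁, 0, r₃, 0, 0, 0, r₁ ^ 2 / r₃, 0, r₁] ∧
    L₁ = !![0, -(r₁ / 2), 0;
            0, 0, 0;
            0, (2 - r₃) / 2, 0] ∧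
    L₂ = !![r₁ / 2, α, -(r₁ ^ 2 / (2 * r₃));
            0, 0, 0;
            r₃ / 2, β, -(r₁ / 2)]

/-- The third family: type `A` with `r₁ = r₂ = 0`, first kind. -/
def IsFamily3 {K : Type*} [Field K] (r : Fin 9 → K) (L₁ L₂ : Matrix (Fin 3) (Fin 3) K) : Prop :=
  ∃ r₃ α β γ δ : K, r₃ ≠ 0 ∧ β ≠ 0 ∧ r = ![0, 0, r₃, 0, 0, 0, 0, 0, 0] ∧
    L₁ = !![α, -(α ^ 2 / β), 0;
            β, -α, 0;
            γ, δ, 0] ∧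
    L₂ = !![-(α ^ 2 / β), α ^ 3 / β ^ 2, 0;
            -α, α ^ 2 / β, 0;
            r₃ - 1 + δ, α * (β * (1 - r₃) - α * γ - 2 * β * δ) / β ^ 2, 0]

/-- The fourth family: type `A` with `r₁ = r₂ = 0`, second kind. -/
def IsFamily4 {K : Type*} [Field K] (r : Fin 9 → K) (L₁ L₂ : Matrix (Fin 3) (Fin 3) K) : Prop :=
  ∃ r₃ α β γ δ : K, r₃ ≠ 0 ∧ α * γ = 0 ∧ r = ![0, 0, r₃, 0, 0, 0, 0, 0, 0] ∧
    L₁ = !![0, 0, 0;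
            0, 0, 0;
            α, β, 0] ∧
    L₂ = !![0, γ, 0;
            0, 0, 0;
            r₃ - 1 + β, δ, 0]

/-- The fifth family: type `B`. -/
def IsFamily5 {K : Type*} [Field K] (r : Fin 9 → K) (L₁ L₂ : Matrix (Fin 3) (Fin 3) K) : Prop :=
  ∃ r₄ r₅ α β : K, r₅ ≠ 0 ∧ r = typeB r₄ r₅ ∧
    L₁ = !![r₄ * α / r₅, -(r₄ ^ 2 * α / r₅ ^ 2), -(r₄ / 2);
            α, -(r₄ * α / r₅), -(r₅ / 2);
            β, -(r₄ * β / r₅), 0] ∧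
    L₂ = !![-(r₄ ^ 2 * α / r₅ ^ 2), r₄ ^ 3 * α / r₅ ^ 3, r₄ ^ 2 / (2 * r₅);
            -(r₄ * α / r₅), r₄ ^ 2 * α / r₅ ^ 2, r₄ / 2;
            -((r₄ * β + r₅) / r₅), r₄ * (r₄ * β + r₅) / r₅ ^ 2, 0]

/-- The sixth family: type `C`. -/
def IsFamily6 {K : Type*} [Field K] (r : Fin 9 → K) (L₁ L₂ : Matrix (Fin 3) (Fin 3) K) : Prop :=
  ∃ r₇ α β : K, r₇ ≠ 0 ∧ r = typeC r₇ ∧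
    L₁ = !![0, 0, 0;
            0, 0, 0;
            0, 1, 0] ∧
    L₂ = !![0, α, -(r₇ / 2);
            0, 0, 0;
            0, β, 0]

/-- The structure constants `r` and the matrices `L₁ = L(e₁)`, `L₂ = L(e₂)` belong to one of the
six families. -/
def IsInList {K : Type*} [Field K] (r : Fin 9 → K) (L₁ L₂ : Matrix (Fin 3) (Fin 3) K) : Prop :=
  IsFamily1 r L₁ L₂ ∨ IsFamily2 r L₁ L₂ ∨ IsFamily3 r L₁ L₂ ∨
    IsFamily4 r L₁ L₂ ∨ IsFamily5 r L₁ L₂ ∨ IsFamily6 r L₁ L₂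

/-! The bracket of `𝔫` is `{x, y} = ω(x, y) z`, with `z` spanning the centre and `ω` a nonzero
alternating form whose radical contains `z`. The last nonzero coordinate of `z` decides between
types A, B and C (`exists_structureConstants_type`).

`post3` says that each `L(x)` is a derivation of `𝔫`. Such a map preserves `K z`, induces a 2×2
block on `V / K z`, and scales `z` by the trace of that block. `post2` says that `L` is a
representation of `𝔤`, so `L(e₃) = [L(e₁), L(e₂)]` commutes with `L(e₁)` and `L(e₂)`. For 2×2 blocks
in characteristic zero such a commutator vanishes (`commutator_eq_zero_of_commute`). Hence the
blocks of `L(e₁)` and `L(e₂)` commute and `L(e₃)` maps `V` into `K z` and kills `z`: only two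
scalars `X`, `Y` of it survive.

`post1` links these data. It gives a linear formula for `X`, `Y`, while the commutator gives another
one; comparing them produces a factor 2, whence `L(e₃) = -½ Ad(e₃)`. When `z` is a multiple of `e₃`,
both sides are zero and a nilpotency argument is needed instead (`typeA_trace_eq_zero`). What
remains is solving for commuting blocks. The converse is a direct check of polynomial identities. -/

/-- The matrices of the operators `Ad(e₁), Ad(e₂), Ad(e₃)` for the alternating bracket with structure
constants `r`. -/
def adMatrix {K : Type*} [Field K] (r : Fin 9 → K) : Fin 3 → Matrix (Fin 3) (Fin 3) K :=
  ![!![0, r 0, r 3; 0, r 1, r 4; 0, r 2, r 5],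
    !![-r 0, 0, r 6; -r 1, 0, r 7; -r 2, 0, r 8],
    !![-r 3, -r 6, 0; -r 4, -r 7, 0; -r 5, -r 8, 0]]

/-- The structure constants of the Heisenberg Lie algebra in its standard basis. -/
def heisenbergConstants (K : Type*) [Field K] : Fin 9 → K := ![0, 0, 1, 0, 0, 0, 0, 0, 0]

/-- The axioms of a PA-structure, in terms of the matrices `G i`, `N i` and `L i` of the operators
`[eᵢ, ·]`, `{eᵢ, ·}` and `eᵢ · (·)`. -/
structure IsPAMatrices {K : Type*} [Field K] (G N L : Fin 3 → Matrix (Fin 3) (Fin 3) K) :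
    Prop where
  post1 : ∀ i j k, L i k j - L j k i = G i k j - N i k j
  post2 : ∀ i j, ∑ l, G i l j • L l = L i * L j - L j * L i
  post3 : ∀ i j, L i * N j = ∑ l, L i l j • N l + N j * L i

/-! ### Matrix form of the axioms, and structure constants of `𝔫` -/

section Coordinates

variable {K V : Type*} [Field K] [AddCommGroup V] [Module K V]

/-- Turns the composite terms of the axioms into sums of matrices: `dot (g x y)` in `post2` and `n
(dot x y)` in `post3`. -/
lemma toMatrix_apply_apply (e : Module.Basis (Fin 3) K V) (b c : V →ₗ[K] V →ₗ[K] V)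
    (i j : Fin 3) :
    LinearMap.toMatrix e e (c (b (e i) (e j))) =
      ∑ l, LinearMap.toMatrix e e (b (e i)) l j • LinearMap.toMatrix e e (c (e l)) := by
  conv_lhs => rw [← e.sum_repr (b (e i) (e j))]
  simp only [map_sum, map_smul, LinearMap.toMatrix_apply]

lemma isPAStructure_iff_matrices (e : Module.Basis (Fin 3) K V) (g n dot : V →ₗ[K] V →ₗ[K] V) :
    IsPAStructure g n dot ↔
      IsPAMatrices (fun i => LinearMap.toMatrix e e (g (e i)))
        (fun i => LinearMap.toMatrix e e (n (e i)))
        (fun i => LinearMap.toMatrix e e (dot (e i))) := by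
  constructor
  · rintro ⟨h1, h2, h3⟩
    refine ⟨fun i j k => ?_, fun i j => ?_, fun i j => ?_⟩
    · simpa [LinearMap.toMatrix_apply] using congrArg (fun v => e.repr v k) (h1 (e i) (e j))
    · rw [← toMatrix_apply_apply e g dot, ← LinearMap.toMatrix_mul, ← LinearMap.toMatrix_mul,
        ← map_sub]
      exact congrArg _ (LinearMap.ext fun z => h2 (e i) (e j) z)
    · rw [← toMatrix_apply_apply e dot n, ← LinearMap.toMatrix_mul, ← LinearMap.toMatrix_mul,
        ← map_add]
      exact congrArg _ (LinearMap.ext fun z => h3 (e i) (e j) z)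
  · rintro ⟨h1, h2, h3⟩
    refine ⟨fun x y => ?_, fun x y z => ?_, fun x y z => ?_⟩
    · have : dot - dot.flip = g - n := by
        refine e.ext fun i => e.ext fun j => e.repr.injective (Finsupp.ext fun k => ?_)
        simpa [LinearMap.toMatrix_apply] using h1 i j k
      simpa using congrArg (fun f => f x y) this
    · have : g.compr₂ dot = (LinearMap.mul K (Module.End K V)).compl₁₂ dot dot -
          ((LinearMap.mul K (Module.End K V)).compl₁₂ dot dot).flip := by
        refine e.ext fun i => e.ext fun j => (LinearMap.toMatrix e e).injective ?_
        have := h2 i j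
        rw [← toMatrix_apply_apply e g dot, ← LinearMap.toMatrix_mul, ← LinearMap.toMatrix_mul,
          ← map_sub] at this
        simpa using this
      simpa using congrArg (fun f => f x y z) this
    · have : (LinearMap.mul K (Module.End K V)).compl₁₂ dot n = dot.compr₂ n +
          ((LinearMap.mul K (Module.End K V)).compl₁₂ n dot).flip := by
        refine e.ext fun i => e.ext fun j => (LinearMap.toMatrix e e).injective ?_
        have := h3 i j
        rw [← toMatrix_apply_apply e dot n, ← LinearMap.toMatrix_mul, ← LinearMap.toMatrix_mul,
          ← map_add] at this
        simpa using this
      simpa using congrArg (fun f => f x y z) this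

lemma IsLieBracket.swap {b : V →ₗ[K] V →ₗ[K] V} (hb : IsLieBracket b) (x y : V) :
    b x y = -b y x := by
  have h := hb.1 (x + y)
  simp only [map_add, LinearMap.add_apply, hb.1, zero_add, add_zero] at h
  exact eq_neg_of_add_eq_zero_right h

lemma HasStructureConstants.toMatrix_eq {e : Module.Basis (Fin 3) K V} {b : V →ₗ[K] V →ₗ[K] V}
    {r : Fin 9 → K} (hb : IsLieBracket b) (hr : HasStructureConstants e b r) :
    (fun i => LinearMap.toMatrix e e (b (e i))) = adMatrix r := by
  obtain ⟨h1, h2, h3⟩ := hr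
  have h1' := hb.swap (e 1) (e 0)
  have h2' := hb.swap (e 2) (e 0)
  have h3' := hb.swap (e 2) (e 1)
  rw [h1] at h1'
  rw [h2] at h2'
  rw [h3] at h3'
  funext i
  ext k j
  rw [LinearMap.toMatrix_apply]
  fin_cases i <;> fin_cases j <;>
    simp only [Fin.zero_eta, Fin.mk_one, Fin.reduceFinMk, hb.1, h1, h2, h3, h1', h2', h3'] <;>
    fin_cases k <;> simp [adMatrix]

lemma IsHeisenbergBasis.hasStructureConstants {e : Module.Basis (Fin 3) K V}
    {g : V →ₗ[K] V →ₗ[K] V} (h : IsHeisenbergBasis e g) :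
    HasStructureConstants e g (heisenbergConstants K) := by
  obtain ⟨h1, h2, h3⟩ := h
  simp [HasStructureConstants, heisenbergConstants, h1, h2, h3]

/-- A Lie bracket isomorphic to the Heisenberg one has structure constants of type `A`, `B`
or `C`. -/
lemma exists_structureConstants_type {e : Module.Basis (Fin 3) K V} {g n : V →ₗ[K] V →ₗ[K] V}
    (hg : IsLieBracket g) (hge : IsHeisenbergBasis e g) (hn : IsLieBracket n)
    (hng : BracketsIsomorphic n g) :
    ∃ r : Fin 9 → K, HasStructureConstants e n r ∧
      ((∃ r₁ r₂ r₃ : K, r₃ ≠ 0 ∧ r = typeA r₁ r₂ r₃) ∨ (∃ r₄ r₅ : K, r₅ ≠ 0 ∧ r = typeB r₄ r₅) ∨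
        ∃ r₇ : K, r₇ ≠ 0 ∧ r = typeC r₇) := by
  obtain ⟨φ, hφ⟩ := hng
  obtain ⟨g1, g2, g3⟩ := hge
  have hg' : ∀ x y : V, g x y = (e.repr x 0 * e.repr y 1 - e.repr x 1 * e.repr y 0) • e 2 := by
    intro x y
    conv_lhs => rw [← e.sum_repr x, ← e.sum_repr y]
    simp only [Fin.sum_univ_three, map_add, map_smul, LinearMap.add_apply, LinearMap.smul_apply,
      hg.1, hg.swap (e 1) (e 0), hg.swap (e 2) (e 0), hg.swap (e 2) (e 1), g1, g2, g3]
    module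
  -- Both the centre and the derived algebra of `𝔤` are spanned by `e 2`, so its preimage `z` is
  -- central for `n` and every bracket is a multiple of it.
  obtain ⟨z, hz⟩ : ∃ z, φ z = e 2 := φ.surjective _
  have hz0 : z ≠ 0 := by
    rintro rfl
    exact e.ne_zero 2 (by rw [← hz, map_zero])
  have hnz : ∀ y, n z y = 0 := fun y => φ.injective (by rw [hφ, hz, hg']; simp)
  have hω : ∀ x y, ∃ t : K, n x y = t • z := fun x y =>
    ⟨_, φ.injective (by rw [hφ, hg', map_smul, hz])⟩
  obtain ⟨p, hp⟩ := hω (e 0) (e 1)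
  obtain ⟨q, hq⟩ := hω (e 0) (e 2)
  obtain ⟨s, hs⟩ := hω (e 1) (e 2)
  have hne : ¬ (p = 0 ∧ q = 0 ∧ s = 0) := by
    rintro ⟨rfl, rfl, rfl⟩
    rw [zero_smul] at hp hq hs
    have h1 := hn.swap (e 1) (e 0)
    have h2 := hn.swap (e 2) (e 0)
    have h3 := hn.swap (e 2) (e 1)
    rw [hp, neg_zero] at h1
    rw [hq, neg_zero] at h2
    rw [hs, neg_zero] at h3
    have hzero : n = 0 := by
      refine e.ext fun i => e.ext fun j => ?_
      fin_cases i <;> fin_cases j <;> simp [hn.1, hp, hq, hs, h1, h2, h3]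
    have h := hφ (φ.symm (e 0)) (φ.symm (e 1))
    rw [φ.apply_symm_apply, φ.apply_symm_apply, g1, hzero] at h
    exact e.ne_zero 2 (by simpa using h.symm)
  obtain ⟨a, b, c, hzc⟩ : ∃ a b c : K, z = a • e 0 + b • e 1 + c • e 2 :=
    ⟨_, _, _, by have h := (e.sum_repr z).symm; rwa [Fin.sum_univ_three] at h⟩
  -- The relations `k0`, `k1`, `k2` express `{z, eᵢ} = 0`; they determine `(p, q, s)` up to a scalar
  -- from the coordinates `(a, b, c)` of `z`.
  have k0 : b * p + c * q = 0 := by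
    have h := hnz (e 0)
    rw [hzc] at h
    simp only [map_add, map_smul, LinearMap.add_apply, LinearMap.smul_apply, hn.1,
      hn.swap (e 1) (e 0), hn.swap (e 2) (e 0), hp, hq, smul_zero, zero_add, ← neg_smul, smul_smul,
      ← add_smul] at h
    linear_combination -(smul_eq_zero.1 h).resolve_right hz0
  have k1 : a * p - c * s = 0 := by
    have h := hnz (e 1)
    rw [hzc] at h
    simp only [map_add, map_smul, LinearMap.add_apply, LinearMap.smul_apply, hn.1,
      hn.swap (e 2) (e 1), hp, hs, smul_zero, add_zero, ← neg_smul, smul_smul,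
      ← add_smul] at h
    linear_combination (smul_eq_zero.1 h).resolve_right hz0
  have k2 : a * q + b * s = 0 := by
    have h := hnz (e 2)
    rw [hzc] at h
    simp only [map_add, map_smul, LinearMap.add_apply, LinearMap.smul_apply, hn.1,
      hq, hs, smul_zero, add_zero, smul_smul, ← add_smul] at h
    exact (smul_eq_zero.1 h).resolve_right hz0
  refine ⟨![p * a, p * b, p * c, q * a, q * b, q * c, s * a, s * b, s * c], ?_, ?_⟩
  · refine ⟨?_, ?_, ?_⟩ <;> simp [hp, hq, hs, hzc, smul_smul]
  by_cases hc : c = 0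
  · subst hc
    right
    by_cases hb : b = 0
    · subst hb
      have ha : a ≠ 0 := by
        rintro rfl
        exact hz0 (by simp [hzc])
      have hp0 : p = 0 := by simpa [ha] using k1
      have hq0 : q = 0 := by simpa [ha] using k2
      have hs0 : s ≠ 0 := fun h => hne ⟨hp0, hq0, h⟩
      exact Or.inr ⟨s * a, mul_ne_zero hs0 ha, by simp [typeC, hp0, hq0]⟩
    · have hp0 : p = 0 := by simpa [hb] using k0
      have hs : s = -(q * a / b) := by field_simp; linear_combination k2
      have hq0 : q ≠ 0 := fun h => hne ⟨hp0, h, by simp [hs, h]⟩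
      refine Or.inl ⟨q * a, q * b, mul_ne_zero hq0 hb, ?_⟩
      ext i
      fin_cases i <;> simp [typeB, hp0, hs] <;> field_simp
  · left
    have hq : q = -(b * p / c) := by field_simp; linear_combination k0
    have hs : s = a * p / c := by field_simp; linear_combination -k1
    have hp0 : p ≠ 0 := fun h => hne ⟨h, by simp [hq, h], by simp [hs, h]⟩
    refine ⟨p * a, p * b, p * c, mul_ne_zero hp0 hc, ?_⟩
    ext i
    fin_cases i <;> simp [typeA, hq, hs] <;> field_simp

end Coordinates

/-! ### Reduction of the axioms to finitely many scalar equations -/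

section Verification

variable {K : Type*} [Field K]

lemma adMatrix_swap (r : Fin 9 → K) (i k j : Fin 3) :
    adMatrix r i k j = -adMatrix r j k i := by
  fin_cases i <;> fin_cases j <;> fin_cases k <;> simp [adMatrix]

variable [CharZero K]

/-- An antisymmetric function on pairs of indices vanishes if it does so on pairs `i < j`. -/
lemma eq_zero_of_antisymm {M : Type*} [AddCommGroup M] [Module K M] {f : Fin 3 → Fin 3 → M}
    (hf : ∀ i j, f i j = -f j i) (h01 : f 0 1 = 0) (h02 : f 0 2 = 0) (h12 : f 1 2 = 0)
    (i j : Fin 3) : f i j = 0 := by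
  have hd : ∀ i, f i i = 0 := fun i => by
    have h : (2 : K) • f i i = 0 := by
      rw [two_smul]
      nth_rewrite 1 [hf i i]
      exact neg_add_cancel _
    exact (smul_eq_zero.1 h).resolve_left two_ne_zero
  fin_cases i <;> fin_cases j <;> simp [hd, h01, h02, h12, hf 1 0, hf 2 0, hf 2 1]

/-- `post1` and `post2` are antisymmetric in `x, y`, and `post3` in `y, z`, so index pairs `i < j`
are enough. -/
lemma isPAMatrices_of_lt {r : Fin 9 → K} {L : Fin 3 → Matrix (Fin 3) (Fin 3) K}
    (h1 : ∀ k, L 0 k 1 - L 1 k 0 = ![0, 0, 1] k - ![r 0, r 1, r 2] k ∧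
      L 0 k 2 - L 2 k 0 = -![r 3, r 4, r 5] k ∧ L 1 k 2 - L 2 k 1 = -![r 6, r 7, r 8] k)
    (h2 : L 2 = L 0 * L 1 - L 1 * L 0 ∧ L 0 * L 2 = L 2 * L 0 ∧ L 1 * L 2 = L 2 * L 1)
    (h3 : ∀ i k,
      L i k 0 * r 0 + L i k 1 * r 1 + L i k 2 * r 2 =
        (L i 0 0 + L i 1 1) * ![r 0, r 1, r 2] k - L i 2 0 * ![r 6, r 7, r 8] k +
          L i 2 1 * ![r 3, r 4, r 5] k ∧
      L i k 0 * r 3 + L i k 1 * r 4 + L i k 2 * r 5 =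
        (L i 0 0 + L i 2 2) * ![r 3, r 4, r 5] k + L i 1 0 * ![r 6, r 7, r 8] k +
          L i 1 2 * ![r 0, r 1, r 2] k ∧
      L i k 0 * r 6 + L i k 1 * r 7 + L i k 2 * r 8 =
        (L i 1 1 + L i 2 2) * ![r 6, r 7, r 8] k + L i 0 1 * ![r 3, r 4, r 5] k -
          L i 0 2 * ![r 0, r 1, r 2] k) :
    IsPAMatrices (adMatrix (heisenbergConstants K)) (adMatrix r) L := by
  have g1 : ∀ k, L 0 k 1 - L 1 k 0 = adMatrix (heisenbergConstants K) 0 k 1 - adMatrix r 0 k 1 ∧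
      L 0 k 2 - L 2 k 0 = adMatrix (heisenbergConstants K) 0 k 2 - adMatrix r 0 k 2 ∧
      L 1 k 2 - L 2 k 1 = adMatrix (heisenbergConstants K) 1 k 2 - adMatrix r 1 k 2 := by
    intro k
    obtain ⟨e1, e2, e3⟩ := h1 k
    rw [e1, e2, e3]
    fin_cases k <;> simp [adMatrix, heisenbergConstants]
  have g2 : ∑ l, adMatrix (heisenbergConstants K) 0 l 1 • L l = L 0 * L 1 - L 1 * L 0 ∧
      ∑ l, adMatrix (heisenbergConstants K) 0 l 2 • L l = L 0 * L 2 - L 2 * L 0 ∧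
      ∑ l, adMatrix (heisenbergConstants K) 1 l 2 • L l = L 1 * L 2 - L 2 * L 1 := by
    obtain ⟨e1, e2, e3⟩ := h2
    rw [← e1, e2, e3]
    simp [adMatrix, heisenbergConstants, Fin.sum_univ_three]
  have g3 : ∀ i k,
      ∑ m, L i k m * adMatrix r 0 m 1 =
        ∑ l, (L i l 0 * adMatrix r l k 1 + L i l 1 * adMatrix r 0 k l) ∧
      ∑ m, L i k m * adMatrix r 0 m 2 =
        ∑ l, (L i l 0 * adMatrix r l k 2 + L i l 2 * adMatrix r 0 k l) ∧
      ∑ m, L i k m * adMatrix r 1 m 2 =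
        ∑ l, (L i l 1 * adMatrix r l k 2 + L i l 2 * adMatrix r 1 k l) := by
    intro i k
    obtain ⟨e1, e2, e3⟩ := h3 i k
    simp only [Fin.sum_univ_three]
    refine ⟨?_, ?_, ?_⟩
    · refine Eq.trans ?_ (e1.trans ?_)
      · simp [adMatrix]
      · fin_cases k <;> simp [adMatrix] <;> ring
    · refine Eq.trans ?_ (e2.trans ?_)
      · simp [adMatrix]
      · fin_cases k <;> simp [adMatrix] <;> ring
    · refine Eq.trans ?_ (e3.trans ?_)
      · simp [adMatrix]
      · fin_cases k <;> simp [adMatrix] <;> ring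
  clear h1 h2 h3
  refine ⟨fun i j k => ?_, fun i j => ?_, fun i j => ?_⟩
  · have h := eq_zero_of_antisymm (K := K)
      (f := fun i j => L i k j - L j k i - (adMatrix (heisenbergConstants K) i k j - adMatrix r i k j))
      (fun i j => by
        rw [adMatrix_swap (heisenbergConstants K) i k j, adMatrix_swap r i k j]
        ring)
      (by simp [g1 k]) (by simp [g1 k]) (by simp [g1 k]) i j
    exact sub_eq_zero.1 h
  · have h := eq_zero_of_antisymm (K := K)
      (f := fun i j => ∑ l, adMatrix (heisenbergConstants K) i l j • L l - (L i * L j - L j * L i))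
      (fun i j => by
        simp only [fun l => adMatrix_swap (heisenbergConstants K) i l j, neg_smul,
          Finset.sum_neg_distrib]
        abel)
      (by simp [g2.1]) (by simp [g2.2.1]) (by simp [g2.2.2]) i j
    exact sub_eq_zero.1 h
  · ext k c
    have h := eq_zero_of_antisymm (K := K)
      (f := fun j c => ∑ m, L i k m * adMatrix r j m c -
        ∑ l, (L i l j * adMatrix r l k c + L i l c * adMatrix r j k l))
      (fun j c => by
        simp only [fun m => adMatrix_swap r j m c, fun l => adMatrix_swap r l k c,
          fun l => adMatrix_swap r j k l, mul_neg, Finset.sum_neg_distrib, Finset.sum_add_distrib]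
        ring)
      (by simp [g3 i k]) (by simp [g3 i k]) (by simp [g3 i k]) j c
    rw [sub_eq_zero] at h
    simp only [Matrix.mul_apply, h, Matrix.add_apply, Matrix.sum_apply, Matrix.smul_apply,
      smul_eq_mul, Finset.sum_add_distrib, mul_comm (adMatrix r j k _)]

/-- The axioms of a PA-structure with `L(e₃) = -½ Ad(e₃)`, as equations between matrix entries. -/
lemma isPAMatrices_of_entries {a₁ a₂ a₃ a₄ a₅ a₆ a₇ a₈ a₉
    b₁ b₂ b₃ b₄ b₅ b₆ b₇ b₈ b₉
    r₁ r₂ r₃ r₄ r₅ r₆ r₇ r₈ r₉ : K}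
    (h : a₂ - b₁ = 0 - r₁ ∧
      a₅ - b₄ = 0 - r₂ ∧
      a₈ - b₇ = 1 - r₃ ∧
      a₃ - r₄ / 2 = -r₄ ∧
      a₆ - r₅ / 2 = -r₅ ∧
      a₉ - r₆ / 2 = -r₆ ∧
      b₃ - r₇ / 2 = -r₇ ∧
      b₆ - r₈ / 2 = -r₈ ∧
      b₉ - r₉ / 2 = -r₉)
    (hp : r₄ / 2 = a₁ * b₁ + a₂ * b₄ + a₃ * b₇ - (b₁ * a₁ + b₂ * a₄ + b₃ * a₇) ∧
      r₇ / 2 = a₁ * b₂ + a₂ * b₅ + a₃ * b₈ - (b₁ * a₂ + b₂ * a₅ + b₃ * a₈) ∧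
      0 = a₁ * b₃ + a₂ * b₆ + a₃ * b₉ - (b₁ * a₃ + b₂ * a₆ + b₃ * a₉) ∧
      r₅ / 2 = a₄ * b₁ + a₅ * b₄ + a₆ * b₇ - (b₄ * a₁ + b₅ * a₄ + b₆ * a₇) ∧
      r₈ / 2 = a₄ * b₂ + a₅ * b₅ + a₆ * b₈ - (b₄ * a₂ + b₅ * a₅ + b₆ * a₈) ∧
      0 = a₄ * b₃ + a₅ * b₆ + a₆ * b₉ - (b₄ * a₃ + b₅ * a₆ + b₆ * a₉) ∧
      r₆ / 2 = a₇ * b₁ + a₈ * b₄ + a₉ * b₇ - (b₇ * a₁ + b₈ * a₄ + b₉ * a₇) ∧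
      r₉ / 2 = a₇ * b₂ + a₈ * b₅ + a₉ * b₈ - (b₇ * a₂ + b₈ * a₅ + b₉ * a₈) ∧
      0 = a₇ * b₃ + a₈ * b₆ + a₉ * b₉ - (b₇ * a₃ + b₈ * a₆ + b₉ * a₉))
    (hq : a₁ * (r₄ / 2) + a₂ * (r₅ / 2) + a₃ * (r₆ / 2) = (r₄ / 2) * a₁ + (r₇ / 2) * a₄ + 0 * a₇ ∧
      a₁ * (r₇ / 2) + a₂ * (r₈ / 2) + a₃ * (r₉ / 2) = (r₄ / 2) * a₂ + (r₇ / 2) * a₅ + 0 * a₈ ∧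
      a₁ * 0 + a₂ * 0 + a₃ * 0 = (r₄ / 2) * a₃ + (r₇ / 2) * a₆ + 0 * a₉ ∧
      a₄ * (r₄ / 2) + a₅ * (r₅ / 2) + a₆ * (r₆ / 2) = (r₅ / 2) * a₁ + (r₈ / 2) * a₄ + 0 * a₇ ∧
      a₄ * (r₇ / 2) + a₅ * (r₈ / 2) + a₆ * (r₉ / 2) = (r₅ / 2) * a₂ + (r₈ / 2) * a₅ + 0 * a₈ ∧
      a₄ * 0 + a₅ * 0 + a₆ * 0 = (r₅ / 2) * a₃ + (r₈ / 2) * a₆ + 0 * a₉ ∧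
      a₇ * (r₄ / 2) + a₈ * (r₅ / 2) + a₉ * (r₆ / 2) = (r₆ / 2) * a₁ + (r₉ / 2) * a₄ + 0 * a₇ ∧
      a₇ * (r₇ / 2) + a₈ * (r₈ / 2) + a₉ * (r₉ / 2) = (r₆ / 2) * a₂ + (r₉ / 2) * a₅ + 0 * a₈ ∧
      a₇ * 0 + a₈ * 0 + a₉ * 0 = (r₆ / 2) * a₃ + (r₉ / 2) * a₆ + 0 * a₉)
    (hs : b₁ * (r₄ / 2) + b₂ * (r₅ / 2) + b₃ * (r₆ / 2) = (r₄ / 2) * b₁ + (r₇ / 2) * b₄ + 0 * b₇ ∧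
      b₁ * (r₇ / 2) + b₂ * (r₈ / 2) + b₃ * (r₉ / 2) = (r₄ / 2) * b₂ + (r₇ / 2) * b₅ + 0 * b₈ ∧
      b₁ * 0 + b₂ * 0 + b₃ * 0 = (r₄ / 2) * b₃ + (r₇ / 2) * b₆ + 0 * b₉ ∧
      b₄ * (r₄ / 2) + b₅ * (r₅ / 2) + b₆ * (r₆ / 2) = (r₅ / 2) * b₁ + (r₈ / 2) * b₄ + 0 * b₇ ∧
      b₄ * (r₇ / 2) + b₅ * (r₈ / 2) + b₆ * (r₉ / 2) = (r₅ / 2) * b₂ + (r₈ / 2) * b₅ + 0 * b₈ ∧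
      b₄ * 0 + b₅ * 0 + b₆ * 0 = (r₅ / 2) * b₃ + (r₈ / 2) * b₆ + 0 * b₉ ∧
      b₇ * (r₄ / 2) + b₈ * (r₅ / 2) + b₉ * (r₆ / 2) = (r₆ / 2) * b₁ + (r₉ / 2) * b₄ + 0 * b₇ ∧
      b₇ * (r₇ / 2) + b₈ * (r₈ / 2) + b₉ * (r₉ / 2) = (r₆ / 2) * b₂ + (r₉ / 2) * b₅ + 0 * b₈ ∧
      b₇ * 0 + b₈ * 0 + b₉ * 0 = (r₆ / 2) * b₃ + (r₉ / 2) * b₆ + 0 * b₉)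
    (hx : a₁ * r₁ + a₂ * r₂ + a₃ * r₃ = (a₁ + a₅) * r₁ - a₇ * r₇ + a₈ * r₄ ∧
      a₄ * r₁ + a₅ * r₂ + a₆ * r₃ = (a₁ + a₅) * r₂ - a₇ * r₈ + a₈ * r₅ ∧
      a₇ * r₁ + a₈ * r₂ + a₉ * r₃ = (a₁ + a₅) * r₃ - a₇ * r₉ + a₈ * r₆ ∧
      a₁ * r₄ + a₂ * r₅ + a₃ * r₆ = (a₁ + a₉) * r₄ + a₄ * r₇ + a₆ * r₁ ∧
      a₄ * r₄ + a₅ * r₅ + a₆ * r₆ = (a₁ + a₉) * r₅ + a₄ * r₈ + a₆ * r₂ ∧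
      a₇ * r₄ + a₈ * r₅ + a₉ * r₆ = (a₁ + a₉) * r₆ + a₄ * r₉ + a₆ * r₃ ∧
      a₁ * r₇ + a₂ * r₈ + a₃ * r₉ = (a₅ + a₉) * r₇ + a₂ * r₄ - a₃ * r₁ ∧
      a₄ * r₇ + a₅ * r₈ + a₆ * r₉ = (a₅ + a₉) * r₈ + a₂ * r₅ - a₃ * r₂ ∧
      a₇ * r₇ + a₈ * r₈ + a₉ * r₉ = (a₅ + a₉) * r₉ + a₂ * r₆ - a₃ * r₃)
    (hy : b₁ * r₁ + b₂ * r₂ + b₃ * r₃ = (b₁ + b₅) * r₁ - b₇ * r₇ + b₈ * r₄ ∧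
      b₄ * r₁ + b₅ * r₂ + b₆ * r₃ = (b₁ + b₅) * r₂ - b₇ * r₈ + b₈ * r₅ ∧
      b₇ * r₁ + b₈ * r₂ + b₉ * r₃ = (b₁ + b₅) * r₃ - b₇ * r₉ + b₈ * r₆ ∧
      b₁ * r₄ + b₂ * r₅ + b₃ * r₆ = (b₁ + b₉) * r₄ + b₄ * r₇ + b₆ * r₁ ∧
      b₄ * r₄ + b₅ * r₅ + b₆ * r₆ = (b₁ + b₉) * r₅ + b₄ * r₈ + b₆ * r₂ ∧
      b₇ * r₄ + b₈ * r₅ + b₉ * r₆ = (b₁ + b₉) * r₆ + b₄ * r₉ + b₆ * r₃ ∧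
      b₁ * r₇ + b₂ * r₈ + b₃ * r₉ = (b₅ + b₉) * r₇ + b₂ * r₄ - b₃ * r₁ ∧
      b₄ * r₇ + b₅ * r₈ + b₆ * r₉ = (b₅ + b₉) * r₈ + b₂ * r₅ - b₃ * r₂ ∧
      b₇ * r₇ + b₈ * r₈ + b₉ * r₉ = (b₅ + b₉) * r₉ + b₂ * r₆ - b₃ * r₃)
    (hz : (r₄ / 2) * r₁ + (r₇ / 2) * r₂ + 0 * r₃ =
        ((r₄ / 2) + (r₈ / 2)) * r₁ - (r₆ / 2) * r₇ + (r₉ / 2) * r₄ ∧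
      (r₅ / 2) * r₁ + (r₈ / 2) * r₂ + 0 * r₃ =
        ((r₄ / 2) + (r₈ / 2)) * r₂ - (r₆ / 2) * r₈ + (r₉ / 2) * r₅ ∧
      (r₆ / 2) * r₁ + (r₉ / 2) * r₂ + 0 * r₃ =
        ((r₄ / 2) + (r₈ / 2)) * r₃ - (r₆ / 2) * r₉ + (r₉ / 2) * r₆ ∧
      (r₄ / 2) * r₄ + (r₇ / 2) * r₅ + 0 * r₆ = ((r₄ / 2) + 0) * r₄ + (r₅ / 2) * r₇ + 0 * r₁ ∧
      (r₅ / 2) * r₄ + (r₈ / 2) * r₅ + 0 * r₆ = ((r₄ / 2) + 0) * r₅ + (r₅ / 2) * r₈ + 0 * r₂ ∧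
      (r₆ / 2) * r₄ + (r₉ / 2) * r₅ + 0 * r₆ = ((r₄ / 2) + 0) * r₆ + (r₅ / 2) * r₉ + 0 * r₃ ∧
      (r₄ / 2) * r₇ + (r₇ / 2) * r₈ + 0 * r₉ = ((r₈ / 2) + 0) * r₇ + (r₇ / 2) * r₄ - 0 * r₁ ∧
      (r₅ / 2) * r₇ + (r₈ / 2) * r₈ + 0 * r₉ = ((r₈ / 2) + 0) * r₈ + (r₇ / 2) * r₅ - 0 * r₂ ∧
      (r₆ / 2) * r₇ + (r₉ / 2) * r₈ + 0 * r₉ = ((r₈ / 2) + 0) * r₉ + (r₇ / 2) * r₆ - 0 * r₃) :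
    IsPAMatrices (adMatrix (heisenbergConstants K)) (adMatrix ![r₁, r₂, r₃, r₄, r₅, r₆, r₇, r₈, r₉])
      ![!![a₁, a₂, a₃; a₄, a₅, a₆; a₇, a₈, a₉], !![b₁, b₂, b₃; b₄, b₅, b₆; b₇, b₈, b₉],
        -(1 / 2 : K) • adMatrix ![r₁, r₂, r₃, r₄, r₅, r₆, r₇, r₈, r₉] 2] := by
  have hc : -(1 / 2 : K) • adMatrix ![r₁, r₂, r₃, r₄, r₅, r₆, r₇, r₈, r₉] 2 =
      !![r₄ / 2, r₇ / 2, 0; r₅ / 2, r₈ / 2, 0; r₆ / 2, r₉ / 2, 0] := by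
    ext i j
    fin_cases i <;> fin_cases j <;> simp [adMatrix] <;> ring
  obtain ⟨h₁, h₂, h₃, h₄, h₅, h₆, h₇, h₈, h₉⟩ := h
  obtain ⟨p₁, p₂, p₃, p₄, p₅, p₆, p₇, p₈, p₉⟩ := hp
  obtain ⟨q₁, q₂, q₃, q₄, q₅, q₆, q₇, q₈, q₉⟩ := hq
  obtain ⟨s₁, s₂, s₃, s₄, s₅, s₆, s₇, s₈, s₉⟩ := hs
  obtain ⟨x₁, x₂, x₃, x₄, x₅, x₆, x₇, x₈, x₉⟩ := hx
  obtain ⟨y₁, y₂, y₃, y₄, y₅, y₆, y₇, y₈, y₉⟩ := hy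
  obtain ⟨z₁, z₂, z₃, z₄, z₅, z₆, z₇, z₈, z₉⟩ := hz
  rw [hc]
  refine isPAMatrices_of_lt (fun k => ?_) ⟨?_, ?_, ?_⟩ (fun i k => ?_)
  · fin_cases k
    exacts [⟨h₁, h₄, h₇⟩, ⟨h₂, h₅, h₈⟩, ⟨h₃, h₆, h₉⟩]
  · change !![r₄ / 2, r₇ / 2, 0; r₅ / 2, r₈ / 2, 0; r₆ / 2, r₉ / 2, 0] =
      !![a₁, a₂, a₃; a₄, a₅, a₆; a₇, a₈, a₉] * !![b₁, b₂, b₃; b₄, b₅, b₆; b₇, b₈, b₉] -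
        !![b₁, b₂, b₃; b₄, b₅, b₆; b₇, b₈, b₉] * !![a₁, a₂, a₃; a₄, a₅, a₆; a₇, a₈, a₉]
    rw [Matrix.mul_fin_three, Matrix.mul_fin_three]
    ext i j
    fin_cases i <;> fin_cases j
    exacts [p₁, p₂, p₃, p₄, p₅, p₆, p₇, p₈, p₉]
  · change !![a₁, a₂, a₃; a₄, a₅, a₆; a₇, a₈, a₉] * !![r₄ / 2, r₇ / 2, 0; r₅ / 2, r₈ / 2, 0; r₆ / 2, r₉ / 2, 0] =
      !![r₄ / 2, r₇ / 2, 0; r₅ / 2, r₈ / 2, 0; r₆ / 2, r₉ / 2, 0] * !![a₁, a₂, a₃; a₄, a₅, a₆; a₇, a₈, a₉]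
    rw [Matrix.mul_fin_three, Matrix.mul_fin_three]
    ext i j
    fin_cases i <;> fin_cases j
    exacts [q₁, q₂, q₃, q₄, q₅, q₆, q₇, q₈, q₉]
  · change !![b₁, b₂, b₃; b₄, b₅, b₆; b₇, b₈, b₉] * !![r₄ / 2, r₇ / 2, 0; r₅ / 2, r₈ / 2, 0; r₆ / 2, r₉ / 2, 0] =
      !![r₄ / 2, r₇ / 2, 0; r₅ / 2, r₈ / 2, 0; r₆ / 2, r₉ / 2, 0] * !![b₁, b₂, b₃; b₄, b₅, b₆; b₇, b₈, b₉]
    rw [Matrix.mul_fin_three, Matrix.mul_fin_three]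
    ext i j
    fin_cases i <;> fin_cases j
    exacts [s₁, s₂, s₃, s₄, s₅, s₆, s₇, s₈, s₉]
  · fin_cases i <;> fin_cases k
    exacts [⟨x₁, x₄, x₇⟩, ⟨x₂, x₅, x₈⟩, ⟨x₃, x₆, x₉⟩, ⟨y₁, y₄, y₇⟩, ⟨y₂, y₅, y₈⟩, ⟨y₃, y₆, y₉⟩,
      ⟨z₁, z₄, z₇⟩, ⟨z₂, z₅, z₈⟩, ⟨z₃, z₆, z₉⟩]

end Verification

/-! ### The six families satisfy the axioms -/

section Verification

variable {K : Type*} [Field K] [CharZero K]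

lemma IsFamily1.isPAMatrices {r : Fin 9 → K} {L₁ L₂ : Matrix (Fin 3) (Fin 3) K}
    (h : IsFamily1 r L₁ L₂) :
    IsPAMatrices (adMatrix (heisenbergConstants K)) (adMatrix r)
      ![L₁, L₂, -(1 / 2 : K) • adMatrix r 2] := by
  obtain ⟨r₁, r₂, r₃, α, β, h2, h3, rfl, rfl, rfl⟩ := h
  apply isPAMatrices_of_entries
  all_goals refine ⟨?_, ?_, ?_, ?_, ?_, ?_, ?_, ?_, ?_⟩
  all_goals field_simp
  all_goals ring

lemma IsFamily2.isPAMatrices {r : Fin 9 → K} {L₁ L₂ : Matrix (Fin 3) (Fin 3) K}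
    (h : IsFamily2 r L₁ L₂) :
    IsPAMatrices (adMatrix (heisenbergConstants K)) (adMatrix r)
      ![L₁, L₂, -(1 / 2 : K) • adMatrix r 2] := by
  obtain ⟨r₁, r₃, α, β, h3, rfl, rfl, rfl⟩ := h
  apply isPAMatrices_of_entries
  all_goals refine ⟨?_, ?_, ?_, ?_, ?_, ?_, ?_, ?_, ?_⟩
  all_goals try field_simp
  all_goals ring

lemma IsFamily3.isPAMatrices {r : Fin 9 → K} {L₁ L₂ : Matrix (Fin 3) (Fin 3) K}
    (h : IsFamily3 r L₁ L₂) :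
    IsPAMatrices (adMatrix (heisenbergConstants K)) (adMatrix r)
      ![L₁, L₂, -(1 / 2 : K) • adMatrix r 2] := by
  obtain ⟨r₃, α, β, γ, δ, h3, hβ, rfl, rfl, rfl⟩ := h
  apply isPAMatrices_of_entries
  all_goals refine ⟨?_, ?_, ?_, ?_, ?_, ?_, ?_, ?_, ?_⟩
  all_goals try field_simp
  all_goals ring

lemma IsFamily4.isPAMatrices {r : Fin 9 → K} {L₁ L₂ : Matrix (Fin 3) (Fin 3) K}
    (h : IsFamily4 r L₁ L₂) :
    IsPAMatrices (adMatrix (heisenbergConstants K)) (adMatrix r)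
      ![L₁, L₂, -(1 / 2 : K) • adMatrix r 2] := by
  obtain ⟨r₃, α, β, γ, δ, h3, h, rfl, rfl, rfl⟩ := h
  apply isPAMatrices_of_entries
  all_goals refine ⟨?_, ?_, ?_, ?_, ?_, ?_, ?_, ?_, ?_⟩
  -- The product `α * γ` is the lower middle entry of `[L(e₁), L(e₂)]`, which has to vanish here.
  all_goals first | ring1 | linear_combination -h

lemma IsFamily5.isPAMatrices {r : Fin 9 → K} {L₁ L₂ : Matrix (Fin 3) (Fin 3) K}
    (h : IsFamily5 r L₁ L₂) :
    IsPAMatrices (adMatrix (heisenbergConstants K)) (adMatrix r)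
      ![L₁, L₂, -(1 / 2 : K) • adMatrix r 2] := by
  obtain ⟨r₄, r₅, α, β, h5, rfl, rfl, rfl⟩ := h
  apply isPAMatrices_of_entries
  all_goals refine ⟨?_, ?_, ?_, ?_, ?_, ?_, ?_, ?_, ?_⟩
  all_goals try field_simp
  all_goals ring

lemma IsFamily6.isPAMatrices {r : Fin 9 → K} {L₁ L₂ : Matrix (Fin 3) (Fin 3) K}
    (h : IsFamily6 r L₁ L₂) :
    IsPAMatrices (adMatrix (heisenbergConstants K)) (adMatrix r)
      ![L₁, L₂, -(1 / 2 : K) • adMatrix r 2] := by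
  obtain ⟨r₇, α, β, h7, rfl, rfl, rfl⟩ := h
  apply isPAMatrices_of_entries
  all_goals refine ⟨?_, ?_, ?_, ?_, ?_, ?_, ?_, ?_, ?_⟩
  all_goals ring

lemma IsInList.isPAMatrices {r : Fin 9 → K} {L₁ L₂ : Matrix (Fin 3) (Fin 3) K}
    (h : IsInList r L₁ L₂) :
    IsPAMatrices (adMatrix (heisenbergConstants K)) (adMatrix r)
      ![L₁, L₂, -(1 / 2 : K) • adMatrix r 2] := by
  rcases h with h | h | h | h | h | h
  exacts [h.isPAMatrices, h.isPAMatrices, h.isPAMatrices, h.isPAMatrices, h.isPAMatrices,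
    h.isPAMatrices]

end Verification

/-! ### Heisenberg representations by derivations in block form -/

section Blocks

variable {K : Type*} [Field K]

/-- The matrices of derivations of the Heisenberg Lie algebra, in a basis whose last vector spans
the centre. -/
def derivationBlock (p q s t x y : K) : Matrix (Fin 3) (Fin 3) K :=
  !![p, q, 0; s, t, 0; x, y, p + t]

/-- A commutator of `2 × 2` matrices that commutes with both of them vanishes. -/
lemma commutator_eq_zero_of_commute [CharZero K] {p q s t p' q' s' t' u v w : K}
    (hu : u = q * s' - q' * s) (hv : v = p * q' + q * t' - p' * q - q' * t)
    (hw : w = s * p' + t * s' - s' * p - t' * s)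
    (h1 : v * s = q * w) (h2 : v * (p - t) = 2 * u * q) (h3 : w * (p - t) = 2 * u * s)
    (h1' : v * s' = q' * w) (h2' : v * (p' - t') = 2 * u * q') (h3' : w * (p' - t') = 2 * u * s') :
    u = 0 ∧ v = 0 ∧ w = 0 := by
  have hv0 : v = 0 := by
    -- By `hv`, `v² = v(p - t)q' - v(p' - t')q`, and `h2`, `h2'` turn this into `2uqq' - 2uq'q`.
    have : v ^ 2 = 0 := by linear_combination v * hv + q' * h2 - q * h2'
    exact pow_eq_zero_iff two_ne_zero |>.1 this
  have hw0 : w = 0 := by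
    have : w ^ 2 = 0 := by linear_combination w * hw - s' * h3 + s * h3'
    exact pow_eq_zero_iff two_ne_zero |>.1 this
  refine ⟨?_, hv0, hw0⟩
  subst hv0 hw0
  by_contra hu0
  have e1 : q = 0 := by simpa [hu0] using h2
  have e2 : q' = 0 := by simpa [hu0] using h2'
  exact hu0 (by rw [hu, e1, e2]; ring)

/-- Three derivations of the Heisenberg Lie algebra which represent a second Heisenberg Lie
algebra. -/
lemma derivationBlock_representation [CharZero K]
    {p q s t x y p' q' s' t' x' y' P Q S T X Y : K}
    (h01 : derivationBlock P Q S T X Y =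
      derivationBlock p q s t x y * derivationBlock p' q' s' t' x' y' -
        derivationBlock p' q' s' t' x' y' * derivationBlock p q s t x y)
    (h02 : derivationBlock p q s t x y * derivationBlock P Q S T X Y =
      derivationBlock P Q S T X Y * derivationBlock p q s t x y)
    (h12 : derivationBlock p' q' s' t' x' y' * derivationBlock P Q S T X Y =
      derivationBlock P Q S T X Y * derivationBlock p' q' s' t' x' y') :
    (P = 0 ∧ Q = 0 ∧ S = 0 ∧ T = 0) ∧
    (q * s' = q' * s ∧ p * q' + q * t' = p' * q + q' * t ∧
      s * p' + t * s' = s' * p + t' * s) ∧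
    (X = x * p' + y * s' + (p + t) * x' - (x' * p + y' * s + (p' + t') * x) ∧
      Y = x * q' + y * t' + (p + t) * y' - (x' * q + y' * t + (p' + t') * y)) ∧
    X * p + Y * s = (p + t) * X ∧ X * q + Y * t = (p + t) * Y ∧
    X * p' + Y * s' = (p' + t') * X ∧ X * q' + Y * t' = (p' + t') * Y := by
  simp only [derivationBlock, ← Matrix.ext_iff, Fin.forall_fin_succ, Matrix.sub_apply,
    Matrix.mul_apply, Fin.sum_univ_three] at h01 h02 h12
  simp at h01 h02 h12
  obtain ⟨⟨a1, a2⟩, ⟨a3, a4⟩, a5, a6, a7⟩ := h01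
  obtain ⟨⟨b1, b2⟩, ⟨b3, b4⟩, b5, b6, b7⟩ := h02
  obtain ⟨⟨c1, c2⟩, ⟨c3, c4⟩, c5, c6, c7⟩ := h12
  -- The upper left block of `L(e₃)` is a commutator, hence traceless.
  have hT : T = -P := by linear_combination a1 + a4
  subst hT
  obtain ⟨hP, hQ, hS⟩ := commutator_eq_zero_of_commute (p := p) (q := q) (s := s) (t := t)
    (p' := p') (q' := q') (s' := s') (t' := t') (u := P) (v := Q) (w := S)
    (by linear_combination a1) (by linear_combination a2) (by linear_combination a3)
    (by linear_combination -b1) (by linear_combination b2) (by linear_combination -b3)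
    (by linear_combination -c1) (by linear_combination c2) (by linear_combination -c3)
  subst hP hQ hS
  refine ⟨by simp, ⟨?_, ?_, ?_⟩, ⟨?_, ?_⟩, ?_, ?_, ?_, ?_⟩
  · linear_combination -a1
  · linear_combination -a2
  · linear_combination -a3
  · linear_combination a5
  · linear_combination a6
  · linear_combination -b5
  · linear_combination -b6
  · linear_combination -c5
  · linear_combination -c6

end Blocks

/-! ### Change to a basis adapted to the centre of `𝔫` -/

section Conjugation

variable {K : Type*} [Field K]

lemma conj_commutator {A B C L M N Q R : Matrix (Fin 3) (Fin 3) K} (hRQ : R * Q = 1)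
    (hL : L * Q = Q * A) (hM : M * Q = Q * B) (hN : N * Q = Q * C) (h : N = L * M - M * L) :
    C = A * B - B * A := by
  have hQ : Q * C = Q * (A * B - B * A) := by
    rw [← hN, h, Matrix.sub_mul, Matrix.mul_assoc, Matrix.mul_assoc, hL, hM, ← Matrix.mul_assoc,
      ← Matrix.mul_assoc, hL, hM, Matrix.mul_sub, Matrix.mul_assoc, Matrix.mul_assoc]
  have h' := congrArg (R * ·) hQ
  simpa only [← Matrix.mul_assoc, hRQ, Matrix.one_mul] using h'

/-- Simultaneous block form of a representation of the Heisenberg Lie algebra by derivations. -/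
lemma IsPAMatrices.conj {N L : Fin 3 → Matrix (Fin 3) (Fin 3) K}
    (h : IsPAMatrices (adMatrix (heisenbergConstants K)) N L) {Q R : Matrix (Fin 3) (Fin 3) K}
    (hRQ : R * Q = 1) {B : Fin 3 → Matrix (Fin 3) (Fin 3) K} (hB : ∀ i, L i * Q = Q * B i) :
    B 2 = B 0 * B 1 - B 1 * B 0 ∧ B 0 * B 2 = B 2 * B 0 ∧ B 1 * B 2 = B 2 * B 1 := by
  have h01 := h.post2 0 1
  have h02 := h.post2 0 2
  have h12 := h.post2 1 2
  simp [adMatrix, heisenbergConstants, Fin.sum_univ_three] at h01 h02 h12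
  have h0 : (0 : Matrix (Fin 3) (Fin 3) K) * Q = Q * 0 := by simp
  exact ⟨conj_commutator hRQ (hB 0) (hB 1) (hB 2) h01,
    sub_eq_zero.1 (conj_commutator hRQ (hB 0) (hB 2) h0 h02).symm,
    sub_eq_zero.1 (conj_commutator hRQ (hB 1) (hB 2) h0 h12).symm⟩

end Conjugation

lemma IsPAMatrices.post3_apply {K : Type*} [Field K] {G N L : Fin 3 → Matrix (Fin 3) (Fin 3) K}
    (h : IsPAMatrices G N L) (i j k c : Fin 3) :
    ∑ m, L i k m * N j m c = ∑ l, L i l j * N l k c + ∑ m, N j k m * L i m c := by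
  simpa [Matrix.mul_apply, Matrix.sum_apply] using congrFun (congrFun (h.post3 i j) k) c

/-! ### Type A: the centre has a nonzero `e₃`-coordinate -/

section TypeA

variable {K : Type*} [Field K]

/-- If the centre of the second Heisenberg Lie algebra is spanned by `e₃`, then `e₃` acts trivially. -/
lemma typeA_trace_eq_zero {p q s t x y p' q' s' t' x' y' X Y : K}
    (h1 : q = p') (h2 : t = s') (h4 : X = p + t) (h5 : Y = p' + t')
    (hX : X = x * p' + y * s' + (p + t) * x' - (x' * p + y' * s + (p' + t') * x))
    (hY : Y = x * q' + y * t' + (p + t) * y' - (x' * q + y' * t + (p' + t') * y))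
    (l1 : X * p + Y * s = (p + t) * X) (l2 : X * q + Y * t = (p + t) * Y)
    (l3 : X * p' + Y * s' = (p' + t') * X) (l4 : X * q' + Y * t' = (p' + t') * Y) :
    X = 0 ∧ Y = 0 := by
  subst h1 h2
  -- A 2×2 block minus its trace is minus its adjugate, so `l1`–`l4` say that the row `(X, Y)` is
  -- killed by both adjugates.
  have r1 : X * t = Y * s := by linear_combination -l1
  have r2 : X * q = Y * p := by linear_combination l2
  have r3 : X * t' = Y * t := by linear_combination -l3
  have r4 : X * q' = Y * q := by linear_combination l4
  have hX0 : X = 0 := by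
    -- By `h4` and `l1`, `X² = Xp + Ys`. Inserting the commutator formulas for `X`, `Y` and
    -- multiplying by `X`, every term cancels by `r1`–`r4`.
    have e : X ^ 3 = 0 := by
      linear_combination X * (X * h4 - l1 + p * hX + s * hY) + (y + x') * (p * r1 - s * r2) +
        x * (s * r4 - p * r3 + t * r2 - q * r1)
    exact pow_eq_zero_iff three_ne_zero |>.1 e
  subst hX0
  refine ⟨rfl, ?_⟩
  have e : Y ^ 3 = 0 := by
    linear_combination Y * (Y * h5 - l4 + q' * hX + t' * hY) +
      (y + x') * (t' * r4 - q' * r3) + y' * (q' * r1 - t' * r2)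
  exact pow_eq_zero_iff three_ne_zero |>.1 e

/-- The columns of the base change are `e₁`, `e₂` and the central vector `z = (a, b, 1)`. As `{e₁,
e₂} = c z`, the derivation rule on this one pair already makes `z` an eigenvector with the trace as
eigenvalue. -/
lemma IsPAMatrices.exists_block_typeA {a b c : K} (hc : c ≠ 0)
    {G L : Fin 3 → Matrix (Fin 3) (Fin 3) K}
    (h : IsPAMatrices G (adMatrix ![c * a, c * b, c, -(c * a * b), -(c * b ^ 2), -(c * b),
      c * a ^ 2, c * a * b, c * a]) L) (i : Fin 3) :
    ∃ p q s t x y : K, L i * !![1, 0, a; 0, 1, b; 0, 0, 1] =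
      !![1, 0, a; 0, 1, b; 0, 0, 1] * derivationBlock p q s t x y := by
  have h0 := h.post3_apply i 0 0 1
  have h1 := h.post3_apply i 0 1 1
  have h2 := h.post3_apply i 0 2 1
  simp only [adMatrix, Fin.sum_univ_three] at h0 h1 h2
  simp at h0 h1 h2
  refine ⟨L i 0 0 - a * L i 2 0, L i 0 1 - a * L i 2 1, L i 1 0 - b * L i 2 0,
    L i 1 1 - b * L i 2 1, L i 2 0, L i 2 1, ?_⟩
  ext k l
  fin_cases k <;> fin_cases l <;>
    simp [derivationBlock, Fin.sum_univ_three, Matrix.mul_apply] <;> apply mul_left_cancel₀ hc <;>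
    first
    | linear_combination h0
    | linear_combination h1
    | linear_combination h2

end TypeA

section TypeA

variable {K : Type*} [Field K] [CharZero K]

set_option maxHeartbeats 1000000 in
lemma IsPAMatrices.typeA_mem {a b c : K} (hc : c ≠ 0) {r : Fin 9 → K}
    (hr : r = ![c * a, c * b, c, -(c * a * b), -(c * b ^ 2), -(c * b),
      c * a ^ 2, c * a * b, c * a])
    {L : Fin 3 → Matrix (Fin 3) (Fin 3) K}
    (h : IsPAMatrices (adMatrix (heisenbergConstants K)) (adMatrix r) L) :
    L 2 = -(1 / 2 : K) • adMatrix r 2 ∧ IsInList r (L 0) (L 1) := by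
  have hrA : r = typeA (c * a) (c * b) c := by
    rw [hr]
    ext i
    fin_cases i <;> simp [typeA] <;> field_simp
  set Q : Matrix (Fin 3) (Fin 3) K := !![1, 0, a; 0, 1, b; 0, 0, 1] with hQ
  set R : Matrix (Fin 3) (Fin 3) K := !![1, 0, -a; 0, 1, -b; 0, 0, 1] with hR
  have hRQ : R * Q = 1 := by
    ext i j
    fin_cases i <;> fin_cases j <;> simp [hQ, hR]
  have hQR : Q * R = 1 := by
    ext i j
    fin_cases i <;> fin_cases j <;> simp [hQ, hR]
  have hblock := (hr ▸ h).exists_block_typeA hc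
  obtain ⟨p, q, s, t, x, y, hL0⟩ := hblock 0
  obtain ⟨p', q', s', t', x', y', hL1⟩ := hblock 1
  obtain ⟨P, S', S, T, X, Y, hL2⟩ := hblock 2
  obtain ⟨h01, h02, h12⟩ := h.conj hRQ (B := ![derivationBlock p q s t x y,
    derivationBlock p' q' s' t' x' y', derivationBlock P S' S T X Y])
    (by intro i; fin_cases i; exacts [hL0, hL1, hL2])
  obtain ⟨⟨rfl, rfl, rfl, rfl⟩, ⟨c1, c2, c3⟩, ⟨hX, hY⟩, l1, l2, l3, l4⟩ :=
    derivationBlock_representation h01 h02 h12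
  have hsolve : ∀ {M B : Matrix (Fin 3) (Fin 3) K}, M * Q = Q * B → M = Q * B * R := by
    intro M B hM
    rw [← hM, Matrix.mul_assoc, hQR, Matrix.mul_one]
  have e0 : L 0 = !![p + a * x, q + a * y, (p + t) * a - a * (p + a * x) - b * (q + a * y);
      s + b * x, t + b * y, (p + t) * b - a * (s + b * x) - b * (t + b * y);
      x, y, p + t - a * x - b * y] := by
    rw [hsolve hL0]
    ext i j
    fin_cases i <;> fin_cases j <;> simp [hQ, hR, derivationBlock] <;> ring
  have e1 : L 1 = !![p' + a * x', q' + a * y',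
        (p' + t') * a - a * (p' + a * x') - b * (q' + a * y');
      s' + b * x', t' + b * y', (p' + t') * b - a * (s' + b * x') - b * (t' + b * y');
      x', y', p' + t' - a * x' - b * y'] := by
    rw [hsolve hL1]
    ext i j
    fin_cases i <;> fin_cases j <;> simp [hQ, hR, derivationBlock] <;> ring
  have e2 : L 2 = !![a * X, a * Y, - a * (a * X) - b * (a * Y);
      b * X, b * Y, - a * (b * X) - b * (b * Y);
      X, Y, - a * X - b * Y] := by
    rw [hsolve hL2]
    ext i j
    fin_cases i <;> fin_cases j <;> simp [hQ, hR, derivationBlock] <;> ring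
  have m010 := h.post1 0 1 0
  have m011 := h.post1 0 1 1
  have m012 := h.post1 0 1 2
  have m020 := h.post1 0 2 0
  have m021 := h.post1 0 2 1
  have m022 := h.post1 0 2 2
  have m120 := h.post1 1 2 0
  have m121 := h.post1 1 2 1
  have m122 := h.post1 1 2 2
  simp [e0, e1, e2, hr, adMatrix,
    heisenbergConstants] at m010 m011 m012 m020 m021 m022 m120 m121 m122
  -- `post1` read in the basis `e₁, e₂, z`, where `e₃ = z - a e₁ - b e₂`. In particular `f4`–`f7`
  -- say that both blocks kill the vector `(a, b)`.
  have f1 : p' = q + a := by linear_combination a * m012 - m010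
  have f2 : s' = t + b := by linear_combination b * m012 - m011
  have f3 : x' = y - 1 + c := by linear_combination -m012
  have f4 : a * p + b * q = 0 := by linear_combination a * m022 - m020
  have f5 : a * s + b * t = 0 := by linear_combination b * m022 - m021
  have f6 : a * p' + b * q' = 0 := by linear_combination a * m122 - m120
  have f7 : a * s' + b * t' = 0 := by linear_combination b * m122 - m121
  have f8 : X = p + t - a * x - b * y - c * b := by linear_combination -m022
  have f9 : Y = p' + t' - a * x' - b * y' + c * a := by linear_combination -m122
  clear m010 m011 m012 m020 m021 m022 m120 m121 m122 h01 h02 h12 hL0 hL1 hL2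
  have key : X = -(c * b) / 2 → Y = c * a / 2 → L 2 = -(1 / 2 : K) • adMatrix r 2 := by
    rintro rfl rfl
    rw [e2, hr]
    ext i j
    fin_cases i <;> fin_cases j <;> simp [adMatrix] <;> ring
  by_cases hb : b = 0
  · subst hb
    by_cases ha : a = 0
    · subst ha
      obtain ⟨hX0, hY0⟩ := typeA_trace_eq_zero (by linear_combination -f1)
        (by linear_combination -f2) (by linear_combination f8)
        (by linear_combination f9) hX hY l1 l2 l3 l4
      refine ⟨key (by simp [hX0]) (by simp [hY0]), ?_⟩
      subst hX0 hY0
      simp only [add_zero, zero_mul, sub_zero, mul_zero] at f1 f2 f8 f9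
      subst p' s' x'
      have ht : t = -p := by linear_combination -f8
      subst ht
      have ht' : t' = -q := by linear_combination -f9
      subst ht'
      have hr3 : r = ![0, 0, c, 0, 0, 0, 0, 0, 0] := by rw [hr]; simp
      -- Both blocks are now traceless and commute; the entry `s` separates the third family (`s ≠
      -- 0`) from the fourth.
      have g1 : s * q = -p ^ 2 := by linear_combination c3 / 2
      have g2 : s * q' = -(q * p) := by linear_combination -c1
      by_cases hs : s = 0
      · subst hs
        have hp : p = 0 := by simpa using g1
        subst hp
        have hq : q = 0 := by
          have : q ^ 2 = 0 := by linear_combination -c2 / 2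
          simpa using this
        subst hq
        refine Or.inr (Or.inr (Or.inr (Or.inl ⟨c, x, y, q', y', hc, ?_, hr3, ?_, ?_⟩)))
        · linear_combination -hY
        · rw [e0]
          simp
        · rw [e1]
          simp
          ring
      · have hq : q = -(p ^ 2 / s) := by field_simp; linear_combination g1
        have hq' : q' = p ^ 3 / s ^ 2 := by
          field_simp
          linear_combination s * g2 - p * g1
        have hy' : y' = p * (s * (1 - c) - p * x - 2 * s * y) / s ^ 2 := by
          field_simp
          linear_combination s * hX + x * g1
        refine Or.inr (Or.inr (Or.inl ⟨c, p, s, x, y, hc, hs, hr3, ?_, ?_⟩))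
        · rw [e0, hq]
          simp
        · rw [e1, hq', hy', hq]
          simp
          ring
    · have hp : p = 0 := by simpa [ha] using f4
      have hs : s = 0 := by simpa [ha] using f5
      have hp' : p' = 0 := by simpa [ha] using f6
      have hs' : s' = 0 := by simpa [ha] using f7
      subst hp hs hp' hs'
      have hq : q = -a := by linear_combination -f1
      have ht : t = 0 := by linear_combination -f2
      subst hq ht
      have ht' : t' = 0 := by
        have : a * t' = 0 := by linear_combination -c2
        simpa [ha] using this
      subst ht'
      -- The commutator and `post1` give `X = 0 = -ax` and `Y = ax' = ca - ax'`; the latter is the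
      -- source of the factor ½.
      have hx : x = 0 := by
        have : a * x = 0 := by linear_combination f8 - hX
        simpa [ha] using this
      subst hx
      have hx' : x' = c / 2 := mul_left_cancel₀ ha (by linear_combination (f9 - hY) / 2)
      have hy : y = 1 - c / 2 := by linear_combination hx' - f3
      subst hx' hy
      refine ⟨key (by linear_combination hX) (by linear_combination hY), ?_⟩
      refine Or.inr (Or.inl ⟨c * a, c, q' + a * y', y', hc, ?_, ?_, ?_⟩)
      · rw [hrA]
        simp [typeA]
      · rw [e0]
        ext i j
        fin_cases i <;> fin_cases j <;> simp <;> ring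
      · rw [e1]
        ext i j
        fin_cases i <;> fin_cases j <;> simp <;> field_simp
  · obtain ⟨m, rfl⟩ : ∃ m, s = m * b ^ 2 := ⟨s / b ^ 2, by field_simp⟩
    have ht : t = -(a * m * b) := mul_left_cancel₀ hb (by linear_combination f5)
    have hp : p = a * m * b := by
      refine mul_left_cancel₀ (pow_ne_zero 2 hb) ?_
      linear_combination (-b) * c3 + (b * m * b ^ 2) * f1 + (b * t - b * p + m * b ^ 2 * a) * f2 +
        m * b ^ 2 * f4 - m * b ^ 2 * f7 + (t + b - p) * f5
    have hq : q = -(a ^ 2 * m) := mul_left_cancel₀ hb (by linear_combination f4 - a * hp)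
    have hp' : p' = a - a ^ 2 * m := by linear_combination f1 + hq
    have hs' : s' = b - a * m * b := by linear_combination f2 + ht
    have htr : p + t = 0 := by linear_combination hp + ht
    have htr' : p' + t' = 0 := mul_left_cancel₀ hb (by linear_combination f7 + b * hp' - a * hs')
    -- `L(e₁)` and `L(e₂)` map `a e₁ + b e₂` into `K z` and, having traceless blocks, kill `z`; so
    -- their commutator kills `a e₁ + b e₂`.
    have hXY : a * X + b * Y = 0 := by
      linear_combination a * hX + b * hY + x * f6 + y * f7 - x' * f4 - y' * f5 +
        (a * x' + b * y') * htr - (a * x + b * y) * htr'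
    -- Eliminating `ax + by` and `ax' + by'` by `f8`, `f9`, the commutator formula becomes `X = -X -
    -- cb + m(aX + bY)`.
    have hX' : X = -(c * b) / 2 := by
      linear_combination (hX + x * hp' + y * hs' - x' * hp + x' * htr - x * htr'
        + (1 - a * m) * (htr + f8) - m * b * (htr' + f9) + m * hXY) / 2
    have hY' : Y = c * a / 2 := mul_left_cancel₀ hb (by linear_combination hXY - a * hX')
    refine ⟨key hX' hY', Or.inl ⟨c * a, c * b, c, m * b ^ 2 + b * x, x, mul_ne_zero hc hb, hc, hrA,
      ?_, ?_⟩⟩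
    all_goals
      have hy : y = -(c * b / 2 + a * x) / b := by
        field_simp
        linear_combination 2 * (htr + f8 - hX')
      have hx' : x' = y - 1 + c := f3
      have hy' : y' = (c * a / 2 - a * x') / b := by
        field_simp
        linear_combination 2 * (htr' + f9 - hY')
      have ht' : t' = -(a - a ^ 2 * m) := by linear_combination htr' - hp'
      have hq' : q' = -(a * (a - a ^ 2 * m)) / b := by
        field_simp
        linear_combination f6 - a * hp'
    · rw [e0, hy, hp, hq, ht]
      ext i j
      fin_cases i <;> fin_cases j <;> simp <;> field_simp <;> ring
    · rw [e1, hy', hx', hy, hp', hq', hs', ht']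
      ext i j
      fin_cases i <;> fin_cases j <;> simp <;> field_simp <;> ring

end TypeA

/-! ### Type B: the centre lies in the span of `e₁`, `e₂` but not in `K e₁` -/

section TypeB

variable {K : Type*} [Field K]

/-- Adapted basis `e₁`, `e₃`, `z = (a, 1, 0)`, with `{e₁, e₃} = c z`. -/
lemma IsPAMatrices.exists_block_typeB {a c : K} (hc : c ≠ 0)
    {G L : Fin 3 → Matrix (Fin 3) (Fin 3) K}
    (h : IsPAMatrices G (adMatrix ![0, 0, 0, c * a, c, 0, -(c * a ^ 2), -(c * a), 0]) L)
    (i : Fin 3) :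
    ∃ p q s t x y : K, L i * !![1, 0, a; 0, 0, 1; 0, 1, 0] =
      !![1, 0, a; 0, 0, 1; 0, 1, 0] * derivationBlock p q s t x y := by
  have h0 := h.post3_apply i 0 0 2
  have h1 := h.post3_apply i 0 1 2
  have h2 := h.post3_apply i 0 2 2
  simp only [adMatrix, Fin.sum_univ_three] at h0 h1 h2
  simp at h0 h1 h2
  refine ⟨L i 0 0 - a * L i 1 0, L i 0 2 - a * L i 1 2, L i 2 0,
    L i 2 2, L i 1 0, L i 1 2, ?_⟩
  ext k l
  fin_cases k <;> fin_cases l <;>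
    simp [derivationBlock, Fin.sum_univ_three, Matrix.mul_apply] <;> apply mul_left_cancel₀ hc <;>
    first
    | linear_combination h0
    | linear_combination h1
    | linear_combination h2

variable [CharZero K]

set_option maxHeartbeats 1000000 in
lemma IsPAMatrices.typeB_mem {a c : K} (hc : c ≠ 0) {r : Fin 9 → K}
    (hr : r = ![0, 0, 0, c * a, c, 0, -(c * a ^ 2), -(c * a), 0])
    {L : Fin 3 → Matrix (Fin 3) (Fin 3) K}
    (h : IsPAMatrices (adMatrix (heisenbergConstants K)) (adMatrix r) L) :
    L 2 = -(1 / 2 : K) • adMatrix r 2 ∧ IsInList r (L 0) (L 1) := by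
  set Q : Matrix (Fin 3) (Fin 3) K := !![1, 0, a; 0, 0, 1; 0, 1, 0] with hQ
  set R : Matrix (Fin 3) (Fin 3) K := !![1, -a, 0; 0, 0, 1; 0, 1, 0] with hR
  have hRQ : R * Q = 1 := by
    ext i j
    fin_cases i <;> fin_cases j <;> simp [hQ, hR]
  have hQR : Q * R = 1 := by
    ext i j
    fin_cases i <;> fin_cases j <;> simp [hQ, hR]
  have hblock := (hr ▸ h).exists_block_typeB hc
  obtain ⟨p, q, s, t, x, y, hL0⟩ := hblock 0
  obtain ⟨p', q', s', t', x', y', hL1⟩ := hblock 1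
  obtain ⟨P, S', S, T, X, Y, hL2⟩ := hblock 2
  obtain ⟨h01, h02, h12⟩ := h.conj hRQ (B := ![derivationBlock p q s t x y,
    derivationBlock p' q' s' t' x' y', derivationBlock P S' S T X Y])
    (by intro i; fin_cases i; exacts [hL0, hL1, hL2])
  obtain ⟨⟨rfl, rfl, rfl, rfl⟩, ⟨c1, c2, c3⟩, ⟨hX, hY⟩, -⟩ :=
    derivationBlock_representation h01 h02 h12
  have hsolve : ∀ {M B : Matrix (Fin 3) (Fin 3) K}, M * Q = Q * B → M = Q * B * R := by
    intro M B hM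
    rw [← hM, Matrix.mul_assoc, hQR, Matrix.mul_one]
  have e0 : L 0 = !![p + a * x, (p + t) * a - a * (p + a * x), q + a * y;
      x, p + t - a * x, y; s, -(a * s), t] := by
    rw [hsolve hL0]
    ext i j
    fin_cases i <;> fin_cases j <;> simp [hQ, hR, derivationBlock] <;> ring
  have e1 : L 1 = !![p' + a * x', (p' + t') * a - a * (p' + a * x'), q' + a * y';
      x', p' + t' - a * x', y'; s', -(a * s'), t'] := by
    rw [hsolve hL1]
    ext i j
    fin_cases i <;> fin_cases j <;> simp [hQ, hR, derivationBlock] <;> ring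
  have e2 : L 2 = !![a * X, - a * (a * X), a * Y; X, - a * X, Y; 0, 0, 0] := by
    rw [hsolve hL2]
    ext i j
    fin_cases i <;> fin_cases j <;> simp [hQ, hR, derivationBlock] <;> ring
  have m010 := h.post1 0 1 0
  have m011 := h.post1 0 1 1
  have m012 := h.post1 0 1 2
  have m020 := h.post1 0 2 0
  have m021 := h.post1 0 2 1
  have m022 := h.post1 0 2 2
  have m120 := h.post1 1 2 0
  have m121 := h.post1 1 2 1
  have m122 := h.post1 1 2 2
  simp [e0, e1, e2, hr, adMatrix,
    heisenbergConstants] at m010 m011 m012 m020 m021 m022 m120 m121 m122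
  subst m022 m122
  have hs' : s' = -(a * s) - 1 := by linear_combination -m012
  have hq : q = 0 := by linear_combination m020 - a * m021
  have hq' : q' = 0 := by linear_combination m120 - a * m121
  subst hq hq' hs'
  -- `post1` gives `p' = -ap`, while `c3` reads `s p' = s' p` with `s' = -as - 1`; together they
  -- leave `p = 0`.
  have hp : p = 0 := by
    linear_combination c3 + s * m010 - s * a * m011
  have hp' : p' = 0 := by
    linear_combination -m010 + a * m011 - a * hp
  subst hp hp'
  have hx' : x' = -(a * x) := by linear_combination -m011
  -- The commutator reduces to `X = -y` and `post1` to `y = X - c`.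
  have hX' : X = c / 2 := by linear_combination (hX - m021 - s * (m121 + a * m021)) / 2
  have hy : y = -(c / 2) := by linear_combination m021 + hX'
  have hY' : Y = 0 := by linear_combination hY
  have hy' : y' = a * c / 2 := by linear_combination m121 - a * hX'
  subst hx' hX' hy hY' hy'
  refine ⟨?_, Or.inr (Or.inr (Or.inr (Or.inr (Or.inl ⟨c * a, c, x, s, hc, ?_, ?_, ?_⟩))))⟩
  · rw [e2, hr]
    ext i j
    fin_cases i <;> fin_cases j <;> simp [adMatrix] <;> ring
  · rw [hr]
    ext i
    fin_cases i <;> simp [typeB] <;> field_simp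
  · rw [e0]
    ext i j
    fin_cases i <;> fin_cases j <;> simp <;> field_simp
  · rw [e1]
    ext i j
    fin_cases i <;> fin_cases j <;> simp <;> field_simp <;> ring

end TypeB

/-! ### Type C: the centre is spanned by `e₁` -/

section TypeC

variable {K : Type*} [Field K]

/-- Adapted basis `e₂`, `e₃`, `e₁`, with `{e₂, e₃} = c e₁`. -/
lemma IsPAMatrices.exists_block_typeC {c : K} (hc : c ≠ 0)
    {G L : Fin 3 → Matrix (Fin 3) (Fin 3) K}
    (h : IsPAMatrices G (adMatrix (typeC c)) L) (i : Fin 3) :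
    ∃ p q s t x y : K, L i * !![0, 0, 1; 1, 0, 0; 0, 1, 0] =
      !![0, 0, 1; 1, 0, 0; 0, 1, 0] * derivationBlock p q s t x y := by
  have h0 := h.post3_apply i 1 0 2
  have h1 := h.post3_apply i 1 1 2
  have h2 := h.post3_apply i 1 2 2
  simp only [adMatrix, typeC, Fin.sum_univ_three] at h0 h1 h2
  simp [hc] at h0 h1 h2
  refine ⟨L i 1 1, L i 1 2, L i 2 1, L i 2 2, L i 0 1, L i 0 2, ?_⟩
  ext k l
  fin_cases k <;> fin_cases l <;>
    simp [derivationBlock, Fin.sum_univ_three, Matrix.mul_apply, h1, h2]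
  exact mul_left_cancel₀ hc (by linear_combination h0)

variable [CharZero K]

set_option maxHeartbeats 1000000 in
lemma IsPAMatrices.typeC_mem {c : K} (hc : c ≠ 0) {L : Fin 3 → Matrix (Fin 3) (Fin 3) K}
    (h : IsPAMatrices (adMatrix (heisenbergConstants K)) (adMatrix (typeC c)) L) :
    L 2 = -(1 / 2 : K) • adMatrix (typeC c) 2 ∧ IsInList (typeC c) (L 0) (L 1) := by
  set Q : Matrix (Fin 3) (Fin 3) K := !![0, 0, 1; 1, 0, 0; 0, 1, 0] with hQ
  set R : Matrix (Fin 3) (Fin 3) K := !![0, 1, 0; 0, 0, 1; 1, 0, 0] with hR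
  have hRQ : R * Q = 1 := by
    ext i j
    fin_cases i <;> fin_cases j <;> simp [hQ, hR]
  have hQR : Q * R = 1 := by
    ext i j
    fin_cases i <;> fin_cases j <;> simp [hQ, hR]
  have hblock := h.exists_block_typeC hc
  obtain ⟨p, q, s, t, x, y, hL0⟩ := hblock 0
  obtain ⟨p', q', s', t', x', y', hL1⟩ := hblock 1
  obtain ⟨P, S', S, T, X, Y, hL2⟩ := hblock 2
  obtain ⟨h01, h02, h12⟩ := h.conj hRQ (B := ![derivationBlock p q s t x y,
    derivationBlock p' q' s' t' x' y', derivationBlock P S' S T X Y])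
    (by intro i; fin_cases i; exacts [hL0, hL1, hL2])
  obtain ⟨⟨rfl, rfl, rfl, rfl⟩, ⟨c1, c2, c3⟩, ⟨hX, hY⟩, -⟩ :=
    derivationBlock_representation h01 h02 h12
  have hsolve : ∀ {M B : Matrix (Fin 3) (Fin 3) K}, M * Q = Q * B → M = Q * B * R := by
    intro M B hM
    rw [← hM, Matrix.mul_assoc, hQR, Matrix.mul_one]
  have e0 : L 0 = !![p + t, x, y; 0, p, q; 0, s, t] := by
    rw [hsolve hL0]
    ext i j
    fin_cases i <;> fin_cases j <;> simp [hQ, hR, derivationBlock]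
  have e1 : L 1 = !![p' + t', x', y'; 0, p', q'; 0, s', t'] := by
    rw [hsolve hL1]
    ext i j
    fin_cases i <;> fin_cases j <;> simp [hQ, hR, derivationBlock]
  have e2 : L 2 = !![0, X, Y; 0, 0, 0; 0, 0, 0] := by
    rw [hsolve hL2]
    ext i j
    fin_cases i <;> fin_cases j <;> simp [hQ, hR, derivationBlock]
  have m010 := h.post1 0 1 0
  have m011 := h.post1 0 1 1
  have m012 := h.post1 0 1 2
  have m020 := h.post1 0 2 0
  have m021 := h.post1 0 2 1
  have m022 := h.post1 0 2 2
  have m120 := h.post1 1 2 0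
  have m121 := h.post1 1 2 1
  have m122 := h.post1 1 2 2
  simp [e0, e1, e2, adMatrix, typeC,
    heisenbergConstants] at m010 m011 m012 m020 m021 m022 m120 m121 m122
  subst m011 m012 m020 m021 m022 m121 m122
  have hp' : p' = 0 := by linear_combination c3
  subst hp'
  have hx : x = 0 := by linear_combination m010
  subst hx
  -- The commutator reduces to `X = -y'` and `post1` to `y' = X - c`.
  have hX' : X = c / 2 := by linear_combination (hX - m120) / 2
  have hy' : y' = -(c / 2) := by linear_combination m120 + hX'
  have hY' : Y = 0 := by linear_combination hY
  subst hX' hY' hy'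
  refine ⟨?_, Or.inr (Or.inr (Or.inr (Or.inr (Or.inr ⟨c, x', s', hc, rfl, ?_, ?_⟩))))⟩
  · rw [e2]
    ext i j
    fin_cases i <;> fin_cases j <;> simp [adMatrix, typeC] <;> ring
  · rw [e0]
    ext i j
    fin_cases i <;> fin_cases j <;> simp
  · rw [e1]
    ext i j
    fin_cases i <;> fin_cases j <;> simp

end TypeC

/-! ### Assembly of the classification -/

section Classification

variable {K : Type*} [Field K] [CharZero K]

/-- The classification, in terms of matrices. -/
lemma isPAMatrices_iff_isInList {r : Fin 9 → K}
    (hr : (∃ r₁ r₂ r₃ : K, r₃ ≠ 0 ∧ r = typeA r₁ r₂ r₃) ∨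
      (∃ r₄ r₅ : K, r₅ ≠ 0 ∧ r = typeB r₄ r₅) ∨ ∃ r₇ : K, r₇ ≠ 0 ∧ r = typeC r₇)
    (L : Fin 3 → Matrix (Fin 3) (Fin 3) K) :
    IsPAMatrices (adMatrix (heisenbergConstants K)) (adMatrix r) L ↔
      L 2 = -(1 / 2 : K) • adMatrix r 2 ∧ IsInList r (L 0) (L 1) := by
  constructor
  · intro h
    rcases hr with ⟨r₁, r₂, r₃, h₃, hr⟩ | ⟨r₄, r₅, h₅, hr⟩ | ⟨r₇, h₇, rfl⟩
    · refine h.typeA_mem (a := r₁ / r₃) (b := r₂ / r₃) h₃ ?_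
      rw [hr]
      ext i
      fin_cases i <;> simp [typeA] <;> field_simp
    · refine h.typeB_mem (a := r₄ / r₅) h₅ ?_
      rw [hr]
      ext i
      fin_cases i <;> simp [typeB] <;> field_simp
    · exact h.typeC_mem h₇
  · rintro ⟨h, hL⟩
    have e : L = ![L 0, L 1, -(1 / 2 : K) • adMatrix r 2] := by
      funext i
      fin_cases i
      exacts [rfl, rfl, h]
    rw [e]
    exact hL.isPAMatrices

end Classification

lemma HasStructureConstants.unique {K V : Type*} [Field K] [AddCommGroup V] [Module K V]
    {e : Module.Basis (Fin 3) K V} {n : V →ₗ[K] V →ₗ[K] V} {r s : Fin 9 → K}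
    (hr : HasStructureConstants e n r) (hs : HasStructureConstants e n s) : r = s := by
  have key : ∀ {x y z x' y' z' : K},
      x • e 0 + y • e 1 + z • e 2 = x' • e 0 + y' • e 1 + z' • e 2 → x = x' ∧ y = y' ∧ z = z' := by
    intro x y z x' y' z' h
    have h' := congrArg e.repr h
    refine ⟨?_, ?_, ?_⟩
    · simpa using DFunLike.congr_fun h' 0
    · simpa using DFunLike.congr_fun h' 1
    · simpa using DFunLike.congr_fun h' 2
  obtain ⟨h0, h1, h2⟩ := key (hr.1.symm.trans hs.1)
  obtain ⟨h3, h4, h5⟩ := key (hr.2.1.symm.trans hs.2.1)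
  obtain ⟨h6, h7, h8⟩ := key (hr.2.2.symm.trans hs.2.2)
  funext i
  fin_cases i
  exacts [h0, h1, h2, h3, h4, h5, h6, h7, h8]

/-- Classification of the PA-structures `dot` on `(𝔤, 𝔫) = ((V, g), (V, n))` with `𝔤 = 𝔫₃(K)` in the
basis `e` and `𝔫 ≅ 𝔤`. Here `L(x) = dot x`, `Ad(x) = n x`, and the matrix of `L(eᵢ)` has the
coordinates of `eᵢ · eⱼ` in its `j`-th column. -/
theorem proposition5p2 {K V : Type*} [Field K] [CharZero K] [AddCommGroup V] [Module K V]
    (e : Module.Basis (Fin 3) K V) (g n dot : V →ₗ[K] V →ₗ[K] V)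
    (hg : IsLieBracket g) (hge : IsHeisenbergBasis e g)
    (hn : IsLieBracket n) (hng : BracketsIsomorphic n g) :
    IsPAStructure g n dot ↔
      dot (e 2) = -(1 / 2 : K) • n (e 2) ∧
      ∃ r : Fin 9 → K, HasStructureConstants e n r ∧
        IsInList r (LinearMap.toMatrix e e (dot (e 0))) (LinearMap.toMatrix e e (dot (e 1))) := by
  obtain ⟨r, hr, hrt⟩ := exists_structureConstants_type hg hge hn hng
  have hN := hr.toMatrix_eq hn
  rw [isPAStructure_iff_matrices e, hge.hasStructureConstants.toMatrix_eq hg, hN,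
    isPAMatrices_iff_isInList hrt, ← congrFun hN 2, ← map_smul]
  refine and_congr (LinearMap.toMatrix e e).injective.eq_iff ⟨fun h => ⟨r, hr, h⟩, ?_⟩
  -- Structure constants are unique, so `s` is the tuple already known to be of type A, B or C.
  rintro ⟨s, hs, h⟩
  rwa [hr.unique hs]
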